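/- Let $\gamma_0,\gamma_1,\gamma_2$ be independent, not necessarily identically distributed, exponential random variables with means $\bar\gamma_0,\bar\gamma_1,\bar\gamma_2>0$ (that is, $P(\gamma_i>x)=e^{-x/\bar\gamma_i}$ for $x\ge 0$), and let $T=\gamma_0\,\frac{\gamma_1+\gamma_2}{\gamma_1\gamma_2}$. Then $T$ has a probability density function with respect to Lebesgue measure; it vanishes for $t\le 0$, and for $t>0$ it is (up to almost everywhere equality) $$ f_T(t)=\sum_{n=0}^{1}\xi_n\,\frac{1}{(t+\zeta)^{3+n}}\;{}_2F_1\!\left(3+n,\,n+\tfrac12;\,\tfrac72;\,\frac{t+\eta}{t+\zeta}\right), $$ where ${}_2F_1(a,b;c;z)=\sum_{k\ge0}\frac{(a)_k(b)_k}{(c)_k}\frac{z^k}{k!}$ is the Gauss hypergeometric function and $$ \xi_n=\sqrt{\pi}\;\bar\gamma_0^{\,3+n}\left(\frac{4}{\sqrt{\bar\gamma_1\bar\gamma_2}}\right)^{n}\frac{\Gamma(3+n)\,\Gamma(3-n)}{\Gamma(7/2)}\,\varpi_n ,\qquad \varpi_0=\frac{4}{\bar\gamma_0\bar\gamma_1\bar\gamma_2},\qquad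 \varpi_1=\frac{2(\bar\gamma_1+\bar\gamma_2)}{\bar\gamma_0(\bar\gamma_1\bar\gamma_2)^{3/2}}, $$ $$ \zeta=\bar\gamma_0\left(\frac1{\bar\gamma_1}+\frac1{\bar\gamma_2}+\frac{2}{\sqrt{\bar\gamma_1\bar\gamma_2}}\right),\qquad \eta=\bar\gamma_0\left(\frac1{\bar\gamma_1}+\frac1{\bar\gamma_2}-\frac{2}{\sqrt{\bar\gamma_1\bar\gamma_2}}\right). $$ -/

import Mathlib

open MeasureTheory ProbabilityTheory

namespace RelayPDF

/-- The constants `ϖ₀` and `ϖ₁`; here `g0`, `g1`, `g2` are the means of the three variables. -/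
noncomputable def varpi (g0 g1 g2 : ℝ) : Fin 2 → ℝ :=
  ![4 / (g0 * g1 * g2),
    2 * (g1 + g2) / (g0 * (g1 * g2) ^ (3 / 2 : ℝ))]

/-- The constants `ξ₀` and `ξ₁`. -/
noncomputable def xi (g0 g1 g2 : ℝ) (n : Fin 2) : ℝ :=
  Real.sqrt Real.pi * g0 ^ (3 + (n : ℕ)) * (4 / Real.sqrt (g1 * g2)) ^ (n : ℕ)
    * (Real.Gamma (3 + ((n : ℕ) : ℝ)) * Real.Gamma (3 - ((n : ℕ) : ℝ)) / Real.Gamma (7 / 2))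
    * varpi g0 g1 g2 n

/-- The constant `ζ`. -/
noncomputable def zeta (g0 g1 g2 : ℝ) : ℝ :=
  g0 * (1 / g1 + 1 / g2 + 2 / Real.sqrt (g1 * g2))

/-- The constant `η`. -/
noncomputable def eta (g0 g1 g2 : ℝ) : ℝ :=
  g0 * (1 / g1 + 1 / g2 - 2 / Real.sqrt (g1 * g2))

/-- The closed form of the density on `t > 0`, extended by `0` to `t ≤ 0`. For `t > 0` the
argument of the hypergeometric series lies in `(0, 1)`, inside its disc of convergence. -/
noncomputable def density (g0 g1 g2 t : ℝ) : ℝ :=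
  if 0 < t then
    ∑ n : Fin 2, xi g0 g1 g2 n * (1 / (t + zeta g0 g1 g2) ^ (3 + (n : ℕ)))
      * ordinaryHypergeometric (3 + ((n : ℕ) : ℝ)) (((n : ℕ) : ℝ) + 1 / 2) (7 / 2 : ℝ)
          ((t + eta g0 g1 g2) / (t + zeta g0 g1 g2))
  else 0

end RelayPDF

/-!
Write `a₀, a, b` for the rates (inverse means) of `γ 0, γ 1, γ 2`, and `X = γ₁γ₂ / (γ₁ + γ₂)`, so
that `T = γ₀ / X`. Conditionally on `γ₁, γ₂`, the variable `T` is exponential with rate `a₀ X`, so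
its density at `t > 0` is `E[a₀ X exp (-a₀ t X)]`. In the coordinates `x = γ₁`, `w = γ₂ / γ₁` one
has `X = x w / (1 + w)`, and the `x`-integral is a Gamma integral; what is left is
`∫₀^∞ 2 a₀ a b κ / (a + b w + a₀ t κ) ^ 3 dw` with `κ = w / (1 + w)` (`lintegral_expMeasure_ratio`).

With `α = √a`, `β = √b`, the Möbius substitution `w = α (1 + x) / (β (1 - x))` symmetrizes the
denominator: up to explicit factors it becomes `A - B x ^ 2`, where `A = a₀ t + a + b + 2 √(a b)`
and `B = a₀ t + a + b - 2 √(a b)`, that is, `(t + ζ) / γ̄₀` and `(t + η) / γ̄₀`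
(`lintegral_ratioKernel`). The odd part of the new integrand drops out, an integration by parts
(`integral_one_sub_pow_four_div`) raises the power of the denominator in one of the two even
parts, and both are then Euler integrals of `₂F₁` at `B / A`. These are evaluated by expanding
`(1 - z x ^ 2) ^ (-(m + 1))` in its binomial series and integrating term by term
(`integral_one_sub_sq_sq_div`, `integral_sq_mul_one_sub_sq_div`, combined in
`integral_eq_hypergeometric`).
-/

open scoped ENNReal

namespace RelayPDF

/-! ### Euler integrals of the hypergeometric function -/

/-- Integration of the binomial series of `(1 - z x ^ 2) ^ (-(m + 1))` term by term against a
continuous weight, for `|z| < 1`. -/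
theorem hasSum_integral_mul_pow {φ : ℝ → ℝ} (hφ : Continuous φ) (m : ℕ) {z : ℝ} (hz : |z| < 1) :
    HasSum (fun k : ℕ => ((k + m).choose m * z ^ k) * ∫ x in (-1 : ℝ)..1, φ x * x ^ (2 * k))
      (∫ x in (-1 : ℝ)..1, φ x / (1 - z * x ^ 2) ^ (m + 1)) := by
  have hsq : ∀ x : ℝ, x ∈ Set.uIoc (-1 : ℝ) 1 → x ^ 2 ≤ 1 := fun x hx => by
    rw [Set.uIoc_of_le (by norm_num)] at hx
    nlinarith [hx.1, hx.2]
  have key : HasSum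
      (fun k : ℕ => ∫ x in (-1 : ℝ)..1, φ x * ((k + m).choose m * (z * x ^ 2) ^ k))
      (∫ x in (-1 : ℝ)..1, φ x * (1 / (1 - z * x ^ 2) ^ (m + 1))) := by
    have hsum := summable_choose_mul_geometric_of_norm_lt_one m
      (show ‖|z|‖ < 1 by simpa using hz)
    refine intervalIntegral.hasSum_integral_of_dominated_convergence
      (fun k x => |φ x| * ((k + m).choose m * |z| ^ k)) (fun k => ?_) (fun k => ?_) ?_ ?_ ?_
    · exact Continuous.aestronglyMeasurable (by fun_prop)
    · refine Filter.Eventually.of_forall fun x hx => ?_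
      rw [Real.norm_eq_abs, abs_mul, abs_mul, abs_pow, abs_mul, Nat.abs_cast,
        abs_of_nonneg (sq_nonneg x)]
      gcongr
      exact mul_le_of_le_one_right (abs_nonneg z) (hsq x hx)
    · exact Filter.Eventually.of_forall fun x _ => hsum.mul_left _
    · simp_rw [tsum_mul_left]
      exact (hφ.abs.mul continuous_const).intervalIntegrable _ _
    · refine Filter.Eventually.of_forall fun x hx => ?_
      refine (hasSum_choose_mul_geometric_of_norm_lt_one m (r := z * x ^ 2) ?_).mul_left (φ x)
      rw [Real.norm_eq_abs, abs_mul, abs_of_nonneg (sq_nonneg x)]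
      exact (mul_le_of_le_one_right (abs_nonneg z) (hsq x hx)).trans_lt hz
  convert key using 2 with k
  · rw [← intervalIntegral.integral_const_mul]
    congr 1 with x
    rw [mul_pow, pow_mul]
    ring
  · ext x
    ring

theorem ascPochhammer_eval_natCast_add_one (m k : ℕ) :
    (ascPochhammer ℝ k).eval ((m : ℝ) + 1) = k.factorial * (k + m).choose m := by
  have h := ascPochhammer_eval_cast (S := ℝ) k (m + 1)
  rw [ascPochhammer_nat_eq_ascFactorial, Nat.ascFactorial_eq_factorial_mul_choose] at h
  push_cast at h
  rw [← h, Nat.add_comm m k, Nat.choose_symm_add]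

/-- The quotient of Pochhammer symbols `(1/2)ₖ / (7/2)ₖ` telescopes, since `7/2 - 1/2` is an
integer. -/
theorem ascPochhammer_eval_half (k : ℕ) :
    (ascPochhammer ℝ k).eval (1 / 2 : ℝ) * ((2 * k + 1) * (2 * k + 3) * (2 * k + 5))
      = 15 * (ascPochhammer ℝ k).eval (7 / 2 : ℝ) := by
  induction k with
  | zero => norm_num
  | succ k ih =>
    rw [ascPochhammer_succ_eval, ascPochhammer_succ_eval]
    push_cast
    linear_combination ((k : ℝ) + 7 / 2) * ih

theorem ascPochhammer_eval_three_halves (k : ℕ) :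
    (ascPochhammer ℝ k).eval (3 / 2 : ℝ) * ((2 * k + 3) * (2 * k + 5))
      = 15 * (ascPochhammer ℝ k).eval (7 / 2 : ℝ) := by
  induction k with
  | zero => norm_num
  | succ k ih =>
    rw [ascPochhammer_succ_eval, ascPochhammer_succ_eval]
    push_cast
    linear_combination ((k : ℝ) + 7 / 2) * ih

theorem integral_even_pow (k : ℕ) :
    ∫ x in (-1 : ℝ)..1, x ^ (2 * k) = 2 / (2 * k + 1) := by
  rw [integral_pow, one_pow, Odd.neg_one_pow ⟨k, rfl⟩]
  push_cast
  ring

/-- Euler's integral for `₂F₁(3, 1/2; 7/2; z)`, in the variable `x` with `x ^ 2` the usual Euler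
variable; the constant is `Γ(1/2) Γ(3) / Γ(7/2)`. -/
theorem integral_one_sub_sq_sq_div {z : ℝ} (hz : |z| < 1) :
    ∫ x in (-1 : ℝ)..1, (1 - x ^ 2) ^ 2 / (1 - z * x ^ 2) ^ 3
      = 16 / 15 * ordinaryHypergeometric 3 (1 / 2) (7 / 2 : ℝ) z := by
  have hs := hasSum_integral_mul_pow (φ := fun x => (1 - x ^ 2) ^ 2) (by fun_prop) 2 hz
  rw [← hs.tsum_eq, ordinaryHypergeometric_eq_tsum, ← tsum_mul_left]
  refine tsum_congr fun k => ?_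
  have hint : ∫ x in (-1 : ℝ)..1, (1 - x ^ 2) ^ 2 * x ^ (2 * k)
      = 16 / ((2 * (k : ℝ) + 1) * (2 * k + 3) * (2 * k + 5)) := by
    have : ∀ x : ℝ, (1 - x ^ 2) ^ 2 * x ^ (2 * k)
        = x ^ (2 * k) - 2 * x ^ (2 * (k + 1)) + x ^ (2 * (k + 2)) := fun x => by ring
    simp_rw [this]
    rw [intervalIntegral.integral_add, intervalIntegral.integral_sub,
      intervalIntegral.integral_const_mul, integral_even_pow, integral_even_pow, integral_even_pow]
    · push_cast
      field_simp
      ring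
    all_goals exact Continuous.intervalIntegrable (by fun_prop) _ _
  have h3 := ascPochhammer_eval_natCast_add_one 2 k
  norm_num at h3
  have hpos : 0 < (ascPochhammer ℝ k).eval (7 / 2 : ℝ) := ascPochhammer_pos k _ (by norm_num)
  rw [hint, h3, smul_eq_mul]
  have hh := ascPochhammer_eval_half k
  have hk : (k.factorial : ℝ) ≠ 0 := by positivity
  field_simp
  linear_combination -((k + 2).choose 2 * z ^ k : ℝ) * hh

/-- Euler's integral for `₂F₁(4, 3/2; 7/2; z)`; the constant is `Γ(3/2) Γ(2) / Γ(7/2)`. -/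
theorem integral_sq_mul_one_sub_sq_div {z : ℝ} (hz : |z| < 1) :
    ∫ x in (-1 : ℝ)..1, x ^ 2 * (1 - x ^ 2) / (1 - z * x ^ 2) ^ 4
      = 4 / 15 * ordinaryHypergeometric 4 (3 / 2) (7 / 2 : ℝ) z := by
  have hs := hasSum_integral_mul_pow (φ := fun x => x ^ 2 * (1 - x ^ 2)) (by fun_prop) 3 hz
  rw [← hs.tsum_eq, ordinaryHypergeometric_eq_tsum, ← tsum_mul_left]
  refine tsum_congr fun k => ?_
  have hint : ∫ x in (-1 : ℝ)..1, x ^ 2 * (1 - x ^ 2) * x ^ (2 * k)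
      = 4 / ((2 * (k : ℝ) + 3) * (2 * k + 5)) := by
    have : ∀ x : ℝ, x ^ 2 * (1 - x ^ 2) * x ^ (2 * k)
        = x ^ (2 * (k + 1)) - x ^ (2 * (k + 2)) := fun x => by ring
    simp_rw [this]
    rw [intervalIntegral.integral_sub, integral_even_pow, integral_even_pow]
    · push_cast
      field_simp
      ring
    all_goals exact Continuous.intervalIntegrable (by fun_prop) _ _
  have h3 := ascPochhammer_eval_natCast_add_one 3 k
  norm_num at h3
  have hpos : 0 < (ascPochhammer ℝ k).eval (7 / 2 : ℝ) := ascPochhammer_pos k _ (by norm_num)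
  rw [hint, h3, smul_eq_mul]
  have hh := ascPochhammer_eval_three_halves k
  have hk : (k.factorial : ℝ) ≠ 0 := by positivity
  field_simp
  linear_combination -((k + 3).choose 3 * z ^ k : ℝ) * hh

theorem sub_mul_sq_pos {A B x : ℝ} (hB : 0 ≤ B) (hBA : B < A) (hx : x ∈ Set.Icc (-1 : ℝ) 1) :
    0 < A - B * x ^ 2 := by
  have : x ^ 2 ≤ 1 := by nlinarith [hx.1, hx.2]
  nlinarith

theorem intervalIntegrable_div_pow {A B : ℝ} (hB : 0 ≤ B) (hBA : B < A) {φ : ℝ → ℝ}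
    (hφ : Continuous φ) (m : ℕ) :
    IntervalIntegrable (fun x => φ x / (A - B * x ^ 2) ^ m) volume (-1) 1 := by
  refine ContinuousOn.intervalIntegrable ?_
  rw [Set.uIcc_of_le (by norm_num)]
  exact hφ.continuousOn.div (by fun_prop)
    fun x hx => (pow_pos (sub_mul_sq_pos hB hBA hx) m).ne'

/-- Integration by parts with the primitive `x (1 - x ^ 2) ^ 2 / (A - B x ^ 2) ^ 3`, which
vanishes at both endpoints. -/
theorem integral_one_sub_pow_four_div {A B : ℝ} (hB : 0 ≤ B) (hBA : B < A) :
    ∫ x in (-1 : ℝ)..1, (1 - x ^ 4) / (A - B * x ^ 2) ^ 3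
      = 6 * (A - B) * ∫ x in (-1 : ℝ)..1, x ^ 2 * (1 - x ^ 2) / (A - B * x ^ 2) ^ 4 := by
  have hI3 : IntervalIntegrable (fun x : ℝ => (1 - x ^ 4) / (A - B * x ^ 2) ^ 3) volume (-1) 1 :=
    intervalIntegrable_div_pow hB hBA (by fun_prop) 3
  have hI4 : IntervalIntegrable (fun x : ℝ => x ^ 2 * (1 - x ^ 2) / (A - B * x ^ 2) ^ 4)
      volume (-1) 1 := intervalIntegrable_div_pow hB hBA (by fun_prop) 4
  have hftc := intervalIntegral.integral_eq_sub_of_hasDerivAt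
    (a := -1) (b := 1) (f := fun x : ℝ => x * (1 - x ^ 2) ^ 2 / (A - B * x ^ 2) ^ 3)
    (f' := fun x : ℝ => (1 - x ^ 4) / (A - B * x ^ 2) ^ 3
      - 6 * (A - B) * (x ^ 2 * (1 - x ^ 2) / (A - B * x ^ 2) ^ 4)) ?_ (hI3.sub (hI4.const_mul _))
  · rw [intervalIntegral.integral_sub hI3 (hI4.const_mul _),
      intervalIntegral.integral_const_mul] at hftc
    norm_num at hftc
    linarith
  · intro x hx
    rw [Set.uIcc_of_le (by norm_num)] at hx
    have hE := (sub_mul_sq_pos hB hBA hx).ne'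
    have h1 : HasDerivAt (fun x : ℝ => A - B * x ^ 2) (-(2 * B * x)) x := by
      refine (((hasDerivAt_pow 2 x).const_mul B).const_sub A).congr_deriv ?_
      norm_num
      ring
    have h2 : HasDerivAt (fun x : ℝ => x * (1 - x ^ 2) ^ 2) (1 - 6 * x ^ 2 + 5 * x ^ 4) x := by
      refine ((hasDerivAt_id' x).fun_mul
        (((hasDerivAt_pow 2 x).const_sub 1).fun_pow 2)).congr_deriv ?_
      norm_num
      ring
    refine (h2.fun_div (h1.fun_pow 3) (pow_ne_zero 3 hE)).congr_deriv ?_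
    -- Treating the denominator as an atom `E` and eliminating `A` keeps the identity of low degree.
    generalize hgen : A - B * x ^ 2 = E at hE ⊢
    obtain rfl : A = E + B * x ^ 2 := by linarith
    field_simp
    ring

/-- The integral left by the Möbius substitution, in closed form. The odd part of the numerator
integrates to zero; the even part is a combination of `(1 - x ^ 2) ^ 2` and `1 - x ^ 4`. -/
theorem integral_eq_hypergeometric {A B α β : ℝ} (hB : 0 ≤ B) (hα : 0 < α) (hβ : 0 < β)
    (hAB : A - B = 4 * (α * β)) :
    ∫ x in (-1 : ℝ)..1, 2 * (1 - x ^ 2) * (α * (1 - x) + β * (1 + x)) ^ 2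
        / (α * β) / (A - B * x ^ 2) ^ 3
      = 64 / 15 / A ^ 3 * ordinaryHypergeometric 3 (1 / 2) (7 / 2 : ℝ) (B / A)
        + 64 / 5 * (α ^ 2 + β ^ 2) / A ^ 4
          * ordinaryHypergeometric 4 (3 / 2) (7 / 2 : ℝ) (B / A) := by
  have hc : 0 < α * β := mul_pos hα hβ
  have hBA : B < A := by linarith
  have hA : 0 < A := by linarith
  have hz : |B / A| < 1 := by
    rw [abs_of_nonneg (by positivity), div_lt_one hA]
    exact hBA
  have hsplit : ∀ x : ℝ, 2 * (1 - x ^ 2) * (α * (1 - x) + β * (1 + x)) ^ 2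
        / (α * β) / (A - B * x ^ 2) ^ 3
      = 4 * ((1 - x ^ 2) ^ 2 / (A - B * x ^ 2) ^ 3)
        + 2 * (α ^ 2 + β ^ 2) / (α * β) * ((1 - x ^ 4) / (A - B * x ^ 2) ^ 3)
        + 4 * (β ^ 2 - α ^ 2) / (α * β) * (x * (1 - x ^ 2) / (A - B * x ^ 2) ^ 3) := fun x => by
    generalize (A - B * x ^ 2) ^ 3 = D
    -- At `D = 0` both sides are `0` by the convention for division, so no bound on `x` is needed.
    rcases eq_or_ne D 0 with rfl | hD
    · simp
    · field_simp
      ring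
  have hodd : ∫ x in (-1 : ℝ)..1, x * (1 - x ^ 2) / (A - B * x ^ 2) ^ 3 = 0 := by
    have h := intervalIntegral.integral_comp_neg (a := -1) (b := 1)
      (fun x : ℝ => x * (1 - x ^ 2) / (A - B * x ^ 2) ^ 3)
    simp only [neg_neg, even_two.neg_pow, neg_mul, neg_div, intervalIntegral.integral_neg] at h
    linarith
  have hfac : ∀ x : ℝ, A - B * x ^ 2 = A * (1 - B / A * x ^ 2) := fun x => by field_simp
  have h0 : ∫ x in (-1 : ℝ)..1, (1 - x ^ 2) ^ 2 / (A - B * x ^ 2) ^ 3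
      = 16 / 15 / A ^ 3 * ordinaryHypergeometric 3 (1 / 2) (7 / 2 : ℝ) (B / A) := by
    simp_rw [hfac, mul_pow A, div_mul_eq_div_div_swap _ (A ^ 3)]
    rw [intervalIntegral.integral_div, integral_one_sub_sq_sq_div hz]
    ring
  have h1 : ∫ x in (-1 : ℝ)..1, x ^ 2 * (1 - x ^ 2) / (A - B * x ^ 2) ^ 4
      = 4 / 15 / A ^ 4 * ordinaryHypergeometric 4 (3 / 2) (7 / 2 : ℝ) (B / A) := by
    simp_rw [hfac, mul_pow A, div_mul_eq_div_div_swap _ (A ^ 4)]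
    rw [intervalIntegral.integral_div, integral_sq_mul_one_sub_sq_div hz]
    ring
  have hi0 : IntervalIntegrable (fun x : ℝ => (1 - x ^ 2) ^ 2 / (A - B * x ^ 2) ^ 3)
      volume (-1) 1 := intervalIntegrable_div_pow hB hBA (by fun_prop) 3
  have hi1 : IntervalIntegrable (fun x : ℝ => (1 - x ^ 4) / (A - B * x ^ 2) ^ 3)
      volume (-1) 1 := intervalIntegrable_div_pow hB hBA (by fun_prop) 3
  have hi2 : IntervalIntegrable (fun x : ℝ => x * (1 - x ^ 2) / (A - B * x ^ 2) ^ 3)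
      volume (-1) 1 := intervalIntegrable_div_pow hB hBA (by fun_prop) 3
  simp_rw [hsplit]
  rw [intervalIntegral.integral_add ((hi0.const_mul _).add (hi1.const_mul _)) (hi2.const_mul _),
    intervalIntegral.integral_add (hi0.const_mul _) (hi1.const_mul _),
    intervalIntegral.integral_const_mul, intervalIntegral.integral_const_mul,
    intervalIntegral.integral_const_mul, hodd, h0, integral_one_sub_pow_four_div hB hBA, h1, hAB]
  field_simp
  ring

/-! ### Integrals against exponential laws -/

/-- An integral against an exponential law, with the null set `{0}` discarded so that the
substitutions below only meet positive values. -/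
theorem lintegral_expMeasure {r : ℝ} (f : ℝ → ℝ≥0∞) (hf : Measurable f) :
    ∫⁻ x, f x ∂expMeasure r
      = ∫⁻ x in Set.Ioi 0, ENNReal.ofReal (r * Real.exp (-(r * x))) * f x := by
  have hm : Measurable (gammaPDF 1 r) := (measurable_gammaPDFReal 1 r).ennreal_ofReal
  rw [expMeasure, gammaMeasure, lintegral_withDensity_eq_lintegral_mul _ hm hf,
    ← lintegral_indicator measurableSet_Ioi]
  refine lintegral_congr_ae ?_
  filter_upwards [Measure.ae_ne volume (0 : ℝ)] with x hx
  rcases hx.lt_or_gt with h | h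
  · simp [gammaPDF_of_neg h, Set.indicator_of_notMem (show x ∉ Set.Ioi 0 from h.not_gt)]
  · simp [gammaPDF_of_nonneg h.le, Set.indicator_of_mem (show x ∈ Set.Ioi 0 from h)]

theorem lintegral_Ioi_comp_mul {c : ℝ} (hc : 0 < c) (f : ℝ → ℝ≥0∞) :
    ∫⁻ x in Set.Ioi 0, f x = ∫⁻ x in Set.Ioi 0, ENNReal.ofReal c * f (c * x) := by
  have himg : (fun x => c * x) '' Set.Ioi 0 = Set.Ioi (0 : ℝ) := by
    rw [Set.image_mul_left_Ioi hc, mul_zero]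
  conv_lhs => rw [← himg]
  rw [lintegral_image_eq_lintegral_abs_deriv_mul (f' := fun _ => c) measurableSet_Ioi
    (fun x _ => by simpa using ((hasDerivAt_id' x).const_mul c).hasDerivWithinAt)
    (mul_right_injective₀ hc.ne').injOn, abs_of_pos hc]

/-- A Gamma integral, read off from the total mass of the Gamma law of shape `3`. -/
theorem lintegral_sq_mul_exp_neg {q : ℝ} (hq : 0 < q) :
    ∫⁻ x in Set.Ioi 0, ENNReal.ofReal (x ^ 2 * Real.exp (-(q * x)))
      = ENNReal.ofReal (2 / q ^ 3) := by
  have h := lintegral_gammaPDF_eq_one (a := 3) (r := q) (by norm_num) hq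
  have hG : Real.Gamma 3 = 2 := by
    rw [show (3 : ℝ) = 2 + 1 by norm_num, Real.Gamma_add_one (by norm_num), Real.Gamma_two, mul_one]
  have h2 : ∫⁻ x, gammaPDF 3 q x = ∫⁻ x in Set.Ioi 0,
      ENNReal.ofReal (q ^ 3 / 2) * ENNReal.ofReal (x ^ 2 * Real.exp (-(q * x))) := by
    rw [← lintegral_indicator measurableSet_Ioi]
    refine lintegral_congr_ae ?_
    filter_upwards [Measure.ae_ne volume (0 : ℝ)] with x hx
    rcases hx.lt_or_gt with h | h
    · simp [gammaPDF_of_neg h, Set.indicator_of_notMem (show x ∉ Set.Ioi 0 from h.not_gt)]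
    · rw [gammaPDF_of_nonneg h.le, Set.indicator_of_mem (show x ∈ Set.Ioi 0 from h), hG,
        ← ENNReal.ofReal_mul (by positivity), show (3 : ℝ) - 1 = (2 : ℕ) by norm_num,
        show (3 : ℝ) = (3 : ℕ) by norm_num, Real.rpow_natCast, Real.rpow_natCast, mul_assoc]
  rw [h2, lintegral_const_mul' _ _ ENNReal.ofReal_ne_top, mul_comm] at h
  rw [ENNReal.eq_inv_of_mul_eq_one_left h, ← ENNReal.ofReal_inv_of_pos (by positivity), inv_div]

theorem lintegral_lintegral_lintegral_reverse {μ ν ρ : Measure ℝ} [SFinite μ] [SFinite ν]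
    [SFinite ρ] {G : ℝ → ℝ → ℝ → ℝ≥0∞} (hG : Measurable fun p : ℝ × ℝ × ℝ => G p.1 p.2.1 p.2.2) :
    ∫⁻ x, ∫⁻ y, ∫⁻ z, G x y z ∂ρ ∂ν ∂μ = ∫⁻ z, ∫⁻ y, ∫⁻ x, G x y z ∂μ ∂ν ∂ρ := by
  have h1 : ∀ x, ∫⁻ y, ∫⁻ z, G x y z ∂ρ ∂ν = ∫⁻ z, ∫⁻ y, G x y z ∂ν ∂ρ := fun x =>
    lintegral_lintegral_swap
      (hG.comp (measurable_const.prodMk (measurable_fst.prodMk measurable_snd))).aemeasurable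
  simp_rw [h1]
  rw [lintegral_lintegral_swap (f := fun x z => ∫⁻ y, G x y z ∂ν)]
  · refine lintegral_congr fun z => lintegral_lintegral_swap ?_
    exact (hG.comp (measurable_fst.prodMk (measurable_snd.prodMk measurable_const))).aemeasurable
  · exact (Measurable.lintegral_prod_right' (f := fun p : (ℝ × ℝ) × ℝ => G p.1.1 p.2 p.1.2)
      (hG.comp (f := fun p : (ℝ × ℝ) × ℝ => (p.1.1, p.2, p.1.2)) (by fun_prop))).aemeasurable

/-- The joint density at `(t, w)`, `t, w > 0`, of `T = Z (X + Y) / (X Y)` and `W = Y / X`, for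
independent exponential `Z, X, Y` of rates `a₀, a, b`. -/
noncomputable def ratioKernel (a₀ a b t w : ℝ) : ℝ :=
  a₀ * a * b * (w / (1 + w)) * (2 / (a + b * w + a₀ * t * (w / (1 + w))) ^ 3)

theorem measurable_ratioKernel (a₀ a b : ℝ) :
    Measurable fun p : ℝ × ℝ => ratioKernel a₀ a b p.1 p.2 := by
  unfold ratioKernel
  fun_prop

/-- For independent exponential variables `Z, X, Y` of rates `a₀, a, b`, the expectation of
`h (Z (X + Y) / (X Y))` is the integral of `h` against the marginal in `t` of `ratioKernel`. -/
theorem lintegral_expMeasure_ratio {a₀ a b : ℝ} (ha₀ : 0 < a₀) (ha : 0 < a) (hb : 0 < b)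
    (h : ℝ → ℝ≥0∞) (hh : Measurable h) :
    ∫⁻ x, ∫⁻ y, ∫⁻ z, h (z * ((x + y) / (x * y))) ∂expMeasure a₀ ∂expMeasure b ∂expMeasure a
      = ∫⁻ t in Set.Ioi 0, h t * ∫⁻ w in Set.Ioi 0, ENNReal.ofReal (ratioKernel a₀ a b t w) := by
  have := isProbabilityMeasure_expMeasure ha₀
  have := isProbabilityMeasure_expMeasure ha
  have := isProbabilityMeasure_expMeasure hb
  have hm : Measurable fun p : (ℝ × ℝ) × ℝ => h (p.2 * ((p.1.1 + p.1.2) / (p.1.1 * p.1.2))) :=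
    hh.comp (by fun_prop)
  have hm1 : Measurable fun p : ℝ × ℝ => ∫⁻ z, h (z * ((p.1 + p.2) / (p.1 * p.2))) ∂expMeasure a₀ :=
    hm.lintegral_prod_right'
  have hm2 : ∀ x, Measurable fun y => ∫⁻ z, h (z * ((x + y) / (x * y))) ∂expMeasure a₀ := fun x =>
    hm1.comp (measurable_const.prodMk measurable_id)
  -- The full integrand in the coordinates `x`, `w = y / x`, `t = z (x + y) / (x y)`.
  let G : ℝ → ℝ → ℝ → ℝ≥0∞ := fun x w t =>
    ENNReal.ofReal (a₀ * a * b * (w / (1 + w))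
      * (x ^ 2 * Real.exp (-((a + b * w + a₀ * t * (w / (1 + w))) * x)))) * h t
  have hG : Measurable fun p : ℝ × ℝ × ℝ => G p.1 p.2.1 p.2.2 := by
    refine Measurable.mul ?_ (hh.comp (by fun_prop))
    fun_prop
  have step : ∀ x ∈ Set.Ioi (0 : ℝ), ENNReal.ofReal (a * Real.exp (-(a * x)))
        * ∫⁻ y, ∫⁻ z, h (z * ((x + y) / (x * y))) ∂expMeasure a₀ ∂expMeasure b
      = ∫⁻ w in Set.Ioi 0, ∫⁻ t in Set.Ioi 0, G x w t := by
    intro x hx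
    have hx : 0 < x := hx
    rw [lintegral_expMeasure _ (hm2 x), lintegral_Ioi_comp_mul hx,
      ← lintegral_const_mul' _ _ ENNReal.ofReal_ne_top]
    refine setLIntegral_congr_fun measurableSet_Ioi fun w hw => ?_
    have hw : 0 < w := hw
    have hX : 0 < x * (w / (1 + w)) := by positivity
    have hmz : Measurable fun z => h (z * ((x + x * w) / (x * (x * w)))) := hh.comp (by fun_prop)
    rw [lintegral_expMeasure _ hmz, lintegral_Ioi_comp_mul hX,
      ← mul_assoc, ← mul_assoc, ← lintegral_const_mul' _ _ (by finiteness)]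
    refine setLIntegral_congr_fun measurableSet_Ioi fun t ht => ?_
    simp only [G]
    have harg : x * (w / (1 + w)) * t * ((x + x * w) / (x * (x * w))) = t := by
      field_simp
    rw [harg, ← mul_assoc, ← mul_assoc, ← ENNReal.ofReal_mul (by positivity),
      ← ENNReal.ofReal_mul (by positivity), ← ENNReal.ofReal_mul (by positivity),
      ← ENNReal.ofReal_mul (by positivity)]
    congr 2
    have hexp : Real.exp (-((a + b * w + a₀ * t * (w / (1 + w))) * x))
        = Real.exp (-(a * x)) * Real.exp (-(b * (x * w)))
          * Real.exp (-(a₀ * (x * (w / (1 + w)) * t))) := by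
      rw [← Real.exp_add, ← Real.exp_add]
      congr 1
      ring
    rw [hexp]
    ring
  rw [lintegral_expMeasure _ (Measurable.lintegral_prod_right' (f := fun p : ℝ × ℝ =>
      ∫⁻ z, h (z * ((p.1 + p.2) / (p.1 * p.2))) ∂expMeasure a₀) hm1),
    setLIntegral_congr_fun measurableSet_Ioi step, lintegral_lintegral_lintegral_reverse hG]
  refine setLIntegral_congr_fun measurableSet_Ioi fun t ht => ?_
  have ht : 0 < t := ht
  have hmw : Measurable fun w => ENNReal.ofReal (ratioKernel a₀ a b t w) :=
    ((measurable_ratioKernel a₀ a b).comp (measurable_const.prodMk measurable_id)).ennreal_ofReal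
  rw [← lintegral_const_mul _ hmw]
  refine setLIntegral_congr_fun measurableSet_Ioi fun w hw => ?_
  have hw : 0 < w := hw
  have hc : 0 ≤ a₀ * a * b * (w / (1 + w)) := by positivity
  simp only [G]
  rw [lintegral_mul_const _ (by fun_prop), mul_comm]
  simp_rw [ENNReal.ofReal_mul hc]
  rw [lintegral_const_mul' _ _ ENNReal.ofReal_ne_top, lintegral_sq_mul_exp_neg (by positivity),
    ← ENNReal.ofReal_mul hc]
  rfl

/-- The marginal of `ratioKernel` after the substitution `w = α (1 + x) / (β (1 - x))`, which maps
`(-1, 1)` onto `(0, ∞)`. -/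
theorem lintegral_ratioKernel {a₀ α β t : ℝ} (ha₀ : 0 < a₀) (hα : 0 < α) (hβ : 0 < β)
    (ht : 0 < t) :
    ∫⁻ w in Set.Ioi 0, ENNReal.ofReal (ratioKernel a₀ (α ^ 2) (β ^ 2) t w)
      = ENNReal.ofReal (2 * a₀ * α ^ 2 * β ^ 2 *
          ∫ x in (-1 : ℝ)..1, 2 * (1 - x ^ 2) * (β * (1 - x) + α * (1 + x)) ^ 2 / (β * α)
            / (a₀ * t + α ^ 2 + β ^ 2 + 2 * (α * β)
                - (a₀ * t + α ^ 2 + β ^ 2 - 2 * (α * β)) * x ^ 2) ^ 3) := by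
  set A := a₀ * t + α ^ 2 + β ^ 2 + 2 * (α * β) with hA
  set B := a₀ * t + α ^ 2 + β ^ 2 - 2 * (α * β) with hB
  have hB0 : 0 ≤ B := by nlinarith [sq_nonneg (α - β), mul_pos ha₀ ht]
  have hBA : B < A := by nlinarith [mul_pos hα hβ]
  let φ : ℝ → ℝ := fun x => α * (1 + x) / (β * (1 - x))
  have himg : φ '' Set.Ioo (-1) 1 = Set.Ioi 0 := by
    ext w
    constructor
    · rintro ⟨x, ⟨h1, h2⟩, rfl⟩
      exact div_pos (mul_pos hα (by linarith)) (mul_pos hβ (by linarith))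
    · intro hw
      have hw : 0 < w := hw
      have hd : 0 < α + β * w := by positivity
      refine ⟨(β * w - α) / (α + β * w), ⟨?_, ?_⟩, ?_⟩
      · rw [lt_div_iff₀ hd]
        nlinarith [mul_pos hβ hw]
      · rw [div_lt_one hd]
        linarith
      · simp only [φ]
        have e1 : 1 + (β * w - α) / (α + β * w) = 2 * (β * w) / (α + β * w) := by
          field_simp
          ring
        have e2 : 1 - (β * w - α) / (α + β * w) = 2 * α / (α + β * w) := by
          field_simp
          ring
        rw [e1, e2]
        field_simp
  have hder : ∀ x ∈ Set.Ioo (-1 : ℝ) 1,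
      HasDerivWithinAt φ (2 * α / (β * (1 - x) ^ 2)) (Set.Ioo (-1) 1) x := by
    intro x hx
    have h1 : 1 - x ≠ 0 := by linarith [hx.2]
    have := (((hasDerivAt_id' x).const_add 1).const_mul α).fun_div
      (((hasDerivAt_id' x).const_sub 1).const_mul β) (mul_ne_zero hβ.ne' h1)
    refine (this.congr_deriv ?_).hasDerivWithinAt
    field_simp
    ring
  have hinj : Set.InjOn φ (Set.Ioo (-1) 1) := by
    intro x hx y hy hxy
    have h1 : 1 - x ≠ 0 := by linarith [hx.2]
    have h2 : 1 - y ≠ 0 := by linarith [hy.2]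
    simp only [φ] at hxy
    field_simp at hxy
    linarith
  have hcont : ContinuousOn (fun x : ℝ => 2 * (1 - x ^ 2) * (β * (1 - x) + α * (1 + x)) ^ 2
      / (β * α) / (A - B * x ^ 2) ^ 3) (Set.Icc (-1) 1) :=
    ContinuousOn.div (by fun_prop) (by fun_prop)
      fun x hx => (pow_pos (sub_mul_sq_pos hB0 hBA hx) 3).ne'
  rw [← himg, lintegral_image_eq_lintegral_abs_deriv_mul measurableSet_Ioo hder hinj,
    intervalIntegral.integral_of_le (by norm_num), ← integral_const_mul,
    integral_Ioc_eq_integral_Ioo,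
    ofReal_integral_eq_lintegral_ofReal]
  · refine setLIntegral_congr_fun measurableSet_Ioo fun x hx => ?_
    have h1 : 0 < 1 - x := by linarith [hx.2]
    have h2 : 0 < 1 + x := by linarith [hx.1]
    have hE := sub_mul_sq_pos hB0 hBA (Set.Ioo_subset_Icc_self hx)
    have hq : 0 < β * (1 - x) + α * (1 + x) := by positivity
    have hd : 0 < 2 * α / (β * (1 - x) ^ 2) := by positivity
    rw [abs_of_pos hd, ← ENNReal.ofReal_mul hd.le]
    congr 1
    have hκ : φ x / (1 + φ x) = α * (1 + x) / (β * (1 - x) + α * (1 + x)) := by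
      simp only [φ]
      field_simp
    have hN : α ^ 2 + β ^ 2 * φ x + a₀ * t * (φ x / (1 + φ x))
        = α * (A - B * x ^ 2) / ((1 - x) * (β * (1 - x) + α * (1 + x))) := by
      rw [hκ, hA, hB]
      simp only [φ]
      field_simp
      ring
    unfold ratioKernel
    rw [hN, hκ]
    generalize A - B * x ^ 2 = E at hE
    field_simp
    ring
  · exact ((hcont.integrableOn_Icc).mono_set Set.Ioo_subset_Icc_self).const_mul _
  · refine (ae_restrict_iff' measurableSet_Ioo).2 (Filter.Eventually.of_forall fun x hx => ?_)
    have hE := sub_mul_sq_pos hB0 hBA (Set.Ioo_subset_Icc_self hx)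
    have : 0 < 1 - x ^ 2 := by nlinarith [hx.1, hx.2]
    simp only [Pi.zero_apply]
    positivity

/-! ### The density of the ratio -/

theorem Gamma_seven_halves : Real.Gamma (7 / 2) = 15 / 8 * Real.sqrt Real.pi := by
  rw [show (7 / 2 : ℝ) = 1 / 2 + 1 + 1 + 1 by norm_num, Real.Gamma_add_one (by norm_num),
    Real.Gamma_add_one (by norm_num), Real.Gamma_add_one (by norm_num), Real.Gamma_one_half_eq]
  ring

/-- The closed-form density in terms of the integral evaluated by `integral_eq_hypergeometric`. -/
theorem density_eq_of_pos {g₀ g₁ g₂ t : ℝ} (h₀ : 0 < g₀) (h₁ : 0 < g₁) (h₂ : 0 < g₂)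
    (ht : 0 < t) {α β : ℝ} (hα : 0 < α) (hβ : 0 < β) (hα1 : α ^ 2 = 1 / g₁) (hβ2 : β ^ 2 = 1 / g₂) :
    RelayPDF.density g₀ g₁ g₂ t = 2 * (1 / g₀) * α ^ 2 * β ^ 2 *
        ∫ x in (-1 : ℝ)..1, 2 * (1 - x ^ 2) * (β * (1 - x) + α * (1 + x)) ^ 2 / (β * α)
          / ((1 / g₀) * t + α ^ 2 + β ^ 2 + 2 * (α * β)
              - ((1 / g₀) * t + α ^ 2 + β ^ 2 - 2 * (α * β)) * x ^ 2) ^ 3 := by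
  have hB : 0 ≤ (1 / g₀) * t + α ^ 2 + β ^ 2 - 2 * (α * β) := by
    have : 0 < (1 / g₀) * t := by positivity
    nlinarith [sq_nonneg (α - β)]
  rw [integral_eq_hypergeometric hB hβ hα (by ring)]
  have hsq : Real.sqrt (g₁ * g₂) = 1 / (α * β) := by
    rw [Real.sqrt_eq_iff_mul_self_eq (by positivity) (by positivity)]
    have e1 : g₁ = 1 / α ^ 2 := by rw [hα1]; simp
    have e2 : g₂ = 1 / β ^ 2 := by rw [hβ2]; simp
    rw [e1, e2]
    field_simp
  have hpow : (g₁ * g₂) ^ (3 / 2 : ℝ) = g₁ * g₂ * Real.sqrt (g₁ * g₂) := by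
    rw [Real.sqrt_eq_rpow, ← Real.rpow_one_add' (by positivity) (by norm_num)]
    norm_num
  obtain rfl : g₁ = 1 / α ^ 2 := by rw [hα1]; simp
  obtain rfl : g₂ = 1 / β ^ 2 := by rw [hβ2]; simp
  have hA0 : 0 < (1 / g₀) * t + α ^ 2 + β ^ 2 + 2 * (α * β) := by positivity
  have hζ : t + RelayPDF.zeta g₀ (1 / α ^ 2) (1 / β ^ 2)
      = g₀ * ((1 / g₀) * t + α ^ 2 + β ^ 2 + 2 * (α * β)) := by
    rw [RelayPDF.zeta, hsq]
    field_simp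
    ring
  have hη : t + RelayPDF.eta g₀ (1 / α ^ 2) (1 / β ^ 2)
      = g₀ * ((1 / g₀) * t + α ^ 2 + β ^ 2 - 2 * (α * β)) := by
    rw [RelayPDF.eta, hsq]
    field_simp
    ring
  have G2 : Real.Gamma 2 = 1 := Real.Gamma_two
  have G3 : Real.Gamma 3 = 2 := by
    rw [show (3 : ℝ) = 2 + 1 by norm_num, Real.Gamma_add_one (by norm_num), G2, mul_one]
  have G4 : Real.Gamma 4 = 6 := by
    rw [show (4 : ℝ) = 3 + 1 by norm_num, Real.Gamma_add_one (by norm_num), G3]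
    norm_num
  have hπ : Real.sqrt Real.pi ≠ 0 := (Real.sqrt_pos.2 Real.pi_pos).ne'
  rw [RelayPDF.density, if_pos ht, Fin.sum_univ_two, hζ, hη, mul_div_mul_left _ _ h₀.ne']
  simp only [RelayPDF.xi, RelayPDF.varpi, hpow, hsq, Gamma_seven_halves, Fin.val_zero, Fin.val_one,
    Matrix.cons_val_zero, Matrix.cons_val_one, Nat.cast_zero, Nat.cast_one, add_zero, sub_zero,
    zero_add]
  rw [show (3 : ℝ) + 1 = 4 by norm_num, show (3 : ℝ) - 1 = 2 by norm_num,
    show (1 : ℝ) + 1 / 2 = 3 / 2 by norm_num, G2, G3, G4]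
  generalize ordinaryHypergeometric (3 : ℝ) (1 / 2 : ℝ) (7 / 2 : ℝ) (_ : ℝ) = F₀
  generalize ordinaryHypergeometric (4 : ℝ) (3 / 2 : ℝ) (7 / 2 : ℝ) (_ : ℝ) = F₁
  generalize (1 / g₀) * t + α ^ 2 + β ^ 2 + 2 * (α * β) = A at hA0
  field_simp
  ring

theorem lintegral_ratioKernel_eq_density {g₀ g₁ g₂ t : ℝ} (h₀ : 0 < g₀) (h₁ : 0 < g₁)
    (h₂ : 0 < g₂) (ht : 0 < t) :
    ∫⁻ w in Set.Ioi 0, ENNReal.ofReal (ratioKernel (1 / g₀) (1 / g₁) (1 / g₂) t w)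
      = ENNReal.ofReal (RelayPDF.density g₀ g₁ g₂ t) := by
  have hα : 0 < Real.sqrt (1 / g₁) := Real.sqrt_pos.2 (by positivity)
  have hβ : 0 < Real.sqrt (1 / g₂) := Real.sqrt_pos.2 (by positivity)
  have hα1 : Real.sqrt (1 / g₁) ^ 2 = 1 / g₁ := Real.sq_sqrt (by positivity)
  have hβ2 : Real.sqrt (1 / g₂) ^ 2 = 1 / g₂ := Real.sq_sqrt (by positivity)
  rw [density_eq_of_pos h₀ h₁ h₂ ht hα hβ hα1 hβ2, ← lintegral_ratioKernel (by positivity) hα hβ ht,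
    hα1, hβ2]

/-- The density is measurable because it is a marginal of the jointly measurable `ratioKernel`. -/
theorem measurable_ofReal_density {g₀ g₁ g₂ : ℝ} (h₀ : 0 < g₀) (h₁ : 0 < g₁) (h₂ : 0 < g₂) :
    Measurable fun t => ENNReal.ofReal (RelayPDF.density g₀ g₁ g₂ t) := by
  have : (fun t => ENNReal.ofReal (RelayPDF.density g₀ g₁ g₂ t)) = (Set.Ioi 0).indicator
      fun t => ∫⁻ w in Set.Ioi 0, ENNReal.ofReal (ratioKernel (1 / g₀) (1 / g₁) (1 / g₂) t w) := by
    ext t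
    by_cases ht : 0 < t
    · rw [Set.indicator_of_mem (show t ∈ Set.Ioi 0 from ht),
        lintegral_ratioKernel_eq_density h₀ h₁ h₂ ht]
    · rw [Set.indicator_of_notMem (show t ∉ Set.Ioi 0 from ht), RelayPDF.density, if_neg ht,
        ENNReal.ofReal_zero]
  rw [this]
  exact ((measurable_ratioKernel _ _ _).ennreal_ofReal.lintegral_prod_right').indicator
    measurableSet_Ioi

theorem map_ratio_eq_withDensity {Ω : Type*} [MeasurableSpace Ω] {P : Measure Ω}
    [IsProbabilityMeasure P] {γ : Fin 3 → Ω → ℝ} {g : Fin 3 → ℝ} (hg : ∀ i, 0 < g i)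
    (hlaw : ∀ i, HasLaw (γ i) (expMeasure (1 / g i)) P) (hindep : iIndepFun γ P) :
    P.map (fun ω => γ 0 ω * ((γ 1 ω + γ 2 ω) / (γ 1 ω * γ 2 ω)))
      = volume.withDensity fun t => ENNReal.ofReal (RelayPDF.density (g 0) (g 1) (g 2) t) := by
  have hm := fun i => (hlaw i).aemeasurable
  have hpos : ∀ i, 0 < 1 / g i := fun i => one_div_pos.2 (hg i)
  have := fun i => isProbabilityMeasure_expMeasure (hpos i)
  have hlaw3 : P.map (fun ω => ((γ 1 ω, γ 2 ω), γ 0 ω))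
      = ((expMeasure (1 / g 1)).prod (expMeasure (1 / g 2))).prod (expMeasure (1 / g 0)) := by
    rw [(indepFun_iff_map_prod_eq_prod_map_map ((hm 1).prodMk (hm 2)) (hm 0)).1
        (hindep.indepFun_prodMk₀ hm 1 2 0 (by decide) (by decide)),
      (indepFun_iff_map_prod_eq_prod_map_map (hm 1) (hm 2)).1 (hindep.indepFun (by decide)),
      (hlaw 0).map_eq, (hlaw 1).map_eq, (hlaw 2).map_eq]
  let T : (ℝ × ℝ) × ℝ → ℝ := fun p => p.2 * ((p.1.1 + p.1.2) / (p.1.1 * p.1.2))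
  have hT : Measurable T := by fun_prop
  have hmap : P.map (fun ω => γ 0 ω * ((γ 1 ω + γ 2 ω) / (γ 1 ω * γ 2 ω)))
      = (P.map (fun ω => ((γ 1 ω, γ 2 ω), γ 0 ω))).map T :=
    (AEMeasurable.map_map_of_aemeasurable hT.aemeasurable
      (((hm 1).prodMk (hm 2)).prodMk (hm 0))).symm
  rw [hmap, hlaw3]
  ext s hs
  have h1s : Measurable (s.indicator (1 : ℝ → ℝ≥0∞)) := measurable_one.indicator hs
  have hcomp : Measurable fun p => s.indicator (1 : ℝ → ℝ≥0∞) (T p) := h1s.comp hT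
  rw [withDensity_apply _ hs, ← lintegral_indicator_one hs, lintegral_map h1s hT,
    lintegral_prod _ hcomp.aemeasurable, lintegral_prod _ hcomp.lintegral_prod_right'.aemeasurable,
    lintegral_expMeasure_ratio (hpos 0) (hpos 1) (hpos 2) _ h1s,
    ← lintegral_indicator measurableSet_Ioi, ← lintegral_indicator hs]
  congr 1 with t
  by_cases ht : 0 < t
  · rw [Set.indicator_of_mem (show t ∈ Set.Ioi 0 from ht),
      lintegral_ratioKernel_eq_density (hg 0) (hg 1) (hg 2) ht]
    by_cases hts : t ∈ s <;> simp [hts]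
  · rw [Set.indicator_of_notMem (show t ∉ Set.Ioi 0 from ht)]
    by_cases hts : t ∈ s <;> simp [hts, RelayPDF.density, ht]

end RelayPDF

theorem lemma2 {Ω : Type*} [MeasurableSpace Ω] (P : Measure Ω) [IsProbabilityMeasure P]
    (γ : Fin 3 → Ω → ℝ) (g : Fin 3 → ℝ) (hg : ∀ i, 0 < g i)
    (hlaw : ∀ i, HasLaw (γ i) (expMeasure (1 / g i)) P)
    (hindep : iIndepFun γ P) :
    HasPDF (fun ω => γ 0 ω * ((γ 1 ω + γ 2 ω) / (γ 1 ω * γ 2 ω))) P volume ∧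
    pdf (fun ω => γ 0 ω * ((γ 1 ω + γ 2 ω) / (γ 1 ω * γ 2 ω))) P volume
      =ᵐ[volume] (fun t => ENNReal.ofReal (RelayPDF.density (g 0) (g 1) (g 2) t)) := by
  have hm := fun i => (hlaw i).aemeasurable
  have hd := (RelayPDF.measurable_ofReal_density (hg 0) (hg 1) (hg 2)).aemeasurable (μ := volume)
  have hmap := RelayPDF.map_ratio_eq_withDensity hg hlaw hindep
  have hpdf : HasPDF (fun ω => γ 0 ω * ((γ 1 ω + γ 2 ω) / (γ 1 ω * γ 2 ω))) P volume :=
    hasPDF_of_map_eq_withDensity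
      ((hm 0).mul (((hm 1).add (hm 2)).div ((hm 1).mul (hm 2)))) _ hd hmap
  exact ⟨hpdf, (pdf.eq_of_map_eq_withDensity _ hd).1 hmap⟩
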